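/- Let $n\ge 1$ and $T$ be integers such that $q:=T-n-1>2$, and let $\Sigma$ be a real symmetric positive definite $n\times n$ matrix. Let $Y_1,\dots,Y_T$ be independent random vectors in $\mathbb{R}^n$ with distribution $N(0,\Sigma)$, let $Y$ be the $T\times n$ matrix with rows $Y_1,\dots,Y_T$, and for a $T\times T$ weighting matrix $B$ put $\widehat{\Sigma}=\frac{1}{\operatorname{Tr}(B)}Y^tBY$. For an invertible $n\times n$ matrix $M$ for which the sum of all entries of $M^{-1}$ is non-zero, let $w(M)\in\mathbb{R}^n$ be the vector with components $$w_i(M)=\frac{\sum_{j}(M^{-1})_{ij}}{\sum_{j,k}(M^{-1})_{jk}}\qquad(1\le i\le n)$$ (the optimal weights of the problem of minimizing $w^tMw$ subject to $\sum_i w_i=1$ when $M$ is positive definite). Define the true risk as $\sqrt{w(\Sigma)^t\,\Sigma\, w(\Sigma)}$, the predicted risk as $\sqrt{w(\widehat\Sigma)^t\,\widehat\Sigma\, w(\widehat\Sigma)}$, and $$Q=\frac{(\text{true risk})^2}{(\text{predicted risk})^2}.$$ If $B=I_T$ (so that $\widehat\Sigma=\frac1T Y^tY$ is the maximum likelihood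 estimator of $\Sigma$), then $\widehat\Sigma$ is almost surely positive definite (so that $Q$ is almost surely well defined), $Q$ has a finite second moment, and $$\operatorname{Var}(Q)=\frac{2T^2}{q^2(q-2)}.$$ -/

import Mathlib

open MeasureTheory ProbabilityTheory
open scoped Matrix

noncomputable section

namespace Portfolio

/-- The weights of the minimum-variance portfolio determined by a covariance matrix `M`:
the `i`-th weight is (sum of the `i`-th row of `M⁻¹`) / (sum of all entries of `M⁻¹`). -/
def weights {n : ℕ} (M : Matrix (Fin n) (Fin n) ℝ) : Fin n → ℝ :=
  fun i => (∑ j, M⁻¹ i j) / ∑ j, ∑ k, M⁻¹ j k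

/-- The risk `√(wᵗ M w)` of the minimum-variance portfolio `w` determined by `M`. For `M = Σ` it
is the true risk, for `M = Σ̂` the predicted risk. -/
def risk {n : ℕ} (M : Matrix (Fin n) (Fin n) ℝ) : ℝ :=
  √(weights M ⬝ᵥ (M *ᵥ weights M))

/-- The `T × n` data matrix whose rows are the observed return vectors `Y_1, …, Y_T`. -/
def dataMatrix {T n : ℕ} (y : Fin T → EuclideanSpace ℝ (Fin n)) : Matrix (Fin T) (Fin n) ℝ :=
  Matrix.of fun i j => y i j

/-- The covariance estimator `Σ̂ = (1 / Tr B) Yᵗ B Y` with weighting matrix `B`. -/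
def estimator {T n : ℕ} (B : Matrix (Fin T) (Fin T) ℝ) (y : Fin T → EuclideanSpace ℝ (Fin n)) :
    Matrix (Fin n) (Fin n) ℝ :=
  (1 / B.trace) • ((dataMatrix y)ᵀ * B * dataMatrix y)

/-- The ratio `Q = (true risk)² / (predicted risk)²`. -/
def riskRatio {T n : ℕ} (S : Matrix (Fin n) (Fin n) ℝ) (B : Matrix (Fin T) (Fin T) ℝ)
    (y : Fin T → EuclideanSpace ℝ (Fin n)) : ℝ :=
  risk S ^ 2 / risk (estimator B y) ^ 2

end Portfolio

end

/-! The squared risk of the optimal weights of a positive definite M is 1 / (1ᵗM⁻¹1), so Q =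
(1ᵗΣ̂⁻¹1) / (1ᵗΣ⁻¹1). Factor Σ = CᵗC so that the all-ones vector is c·Cᵗe₀ (`exists_factor`), and
realize the data in law as Y = XC, where X has independent N(0,1) entries (`map_observations`). Then
C and c cancel, and Q becomes T·((XᵗX)⁻¹)₀₀ (`riskRatio_observations`).

That entry is the reciprocal squared distance from the first column of X to the span of the other k
= n - 1 columns (`inv_gram_zero_zero`). Given those columns, the residual is a standard Gaussian
vector in dimension T - k = q + 2, so Q is distributed as T/χ² with q + 2 degrees of freedom.
Laplace transforms give E[1/χ²] = 1/q and E[1/χ⁴] = 1/(q(q-2)), hence the variance T²(1/(q(q-2)) -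
1/q²). -/

open scoped ENNReal

namespace Portfolio

/-! ### Algebra of the minimal risk. -/

/-- The sum of all entries of the inverse matrix, as a quadratic form. -/
theorem sum_inv_eq {n : ℕ} (M : Matrix (Fin n) (Fin n) ℝ) :
    ∑ j, ∑ k, M⁻¹ j k = 1 ⬝ᵥ (M⁻¹ *ᵥ 1) := by
  simp [dotProduct, Matrix.mulVec]

theorem weights_eq {n : ℕ} (M : Matrix (Fin n) (Fin n) ℝ) :
    weights M = (1 ⬝ᵥ (M⁻¹ *ᵥ 1))⁻¹ • (M⁻¹ *ᵥ 1) := by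
  ext i
  rw [← sum_inv_eq]
  simp [weights, Matrix.mulVec, dotProduct, div_eq_inv_mul]

/-- The minimal variance is the reciprocal of the sum of the entries of the inverse matrix. -/
theorem risk_sq {n : ℕ} {M : Matrix (Fin n) (Fin n) ℝ} (hM : M.PosDef) :
    risk M ^ 2 = (1 ⬝ᵥ (M⁻¹ *ᵥ 1))⁻¹ := by
  have h : weights M ⬝ᵥ (M *ᵥ weights M) = (1 ⬝ᵥ (M⁻¹ *ᵥ 1))⁻¹ := by
    have hdet : IsUnit M.det := (Matrix.isUnit_iff_isUnit_det _).1 hM.isUnit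
    rw [weights_eq, Matrix.mulVec_smul, Matrix.mulVec_mulVec, Matrix.mul_nonsing_inv _ hdet,
      Matrix.one_mulVec, smul_dotProduct, dotProduct_smul, dotProduct_comm (M⁻¹ *ᵥ 1)]
    simp only [smul_eq_mul]
    rcases eq_or_ne (1 ⬝ᵥ (M⁻¹ *ᵥ 1)) 0 with h0 | h0
    · simp [h0]
    · field_simp
  rw [risk, h, Real.sq_sqrt]
  exact inv_nonneg.2 (by simpa using hM.inv.posSemidef.dotProduct_mulVec_nonneg 1)

theorem estimator_one {T n : ℕ} (y : Fin T → EuclideanSpace ℝ (Fin n)) :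
    estimator 1 y = (T : ℝ)⁻¹ • ((dataMatrix y)ᵀ * dataMatrix y) := by
  simp [estimator]

/-- The square root of a positive definite matrix, rotated so that a scalar multiple of a basis
vector is sent to the all-ones vector by the transpose. -/
theorem exists_factor {k : ℕ} {S : Matrix (Fin (k + 1)) (Fin (k + 1)) ℝ} (hS : S.PosDef) :
    ∃ C : Matrix (Fin (k + 1)) (Fin (k + 1)) ℝ, Cᵀ * C = S ∧
      ∃ c : ℝ, c ≠ 0 ∧ (1 : Fin (k + 1) → ℝ) = c • (Cᵀ *ᵥ Pi.single 0 1) := by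
  obtain ⟨R, hR⟩ : ∃ R : Matrix (Fin (k + 1)) (Fin (k + 1)) ℝ, S = Rᵀ * R := by
    open scoped MatrixOrder in
    obtain ⟨R, hR⟩ := CStarAlgebra.nonneg_iff_eq_star_mul_self.mp hS.posSemidef.nonneg
    exact ⟨R, by simpa [Matrix.star_eq_conjTranspose] using hR⟩
  have hdetR : IsUnit Rᵀ.det := by
    have h1 : IsUnit S.det := (Matrix.isUnit_iff_isUnit_det _).1 hS.isUnit
    rw [hR, Matrix.det_mul] at h1
    exact isUnit_of_mul_isUnit_left h1
  set a : Fin (k + 1) → ℝ := Rᵀ⁻¹ *ᵥ 1 with ha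
  have hRa : Rᵀ *ᵥ a = 1 := by
    rw [ha, Matrix.mulVec_mulVec, Matrix.mul_nonsing_inv _ hdetR, Matrix.one_mulVec]
  have ha0 : a ≠ 0 := by
    intro h
    rw [h, Matrix.mulVec_zero] at hRa
    exact zero_ne_one (congrFun hRa 0)
  set a' : EuclideanSpace ℝ (Fin (k + 1)) := WithLp.toLp 2 a with ha'
  have ha'0 : a' ≠ 0 := fun h => ha0 (by simpa [ha'] using h)
  have hnorm : ‖a'‖ ≠ 0 := norm_ne_zero_iff.2 ha'0
  have hv : Orthonormal ℝ (({0} : Set (Fin (k + 1))).domRestrict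
      (fun _ : Fin (k + 1) => ‖a'‖⁻¹ • a')) := by
    refine ⟨fun i => ?_, fun i j hij => (hij (Subsingleton.elim _ _)).elim⟩
    simp [Set.domRestrict, norm_smul, hnorm]
  obtain ⟨b, hb⟩ := hv.exists_orthonormalBasis_extension_of_card_eq (by simp)
  have hb0 : b 0 = ‖a'‖⁻¹ • a' := hb 0 rfl
  -- Row 0 of the orthogonal matrix `O` is a/‖a‖, so (OR)ᵗe₀ = Rᵗa/‖a‖ = 1/‖a‖, while OᵗO = 1 keeps
  -- (OR)ᵗ(OR) = RᵗR.
  set O : Matrix (Fin (k + 1)) (Fin (k + 1)) ℝ := Matrix.of fun i j => b i j with hO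
  have hOO : O * Oᵀ = 1 := by
    ext i j
    have := orthonormal_iff_ite.1 b.orthonormal i j
    rw [Matrix.one_apply, ← this]
    simp [hO, Matrix.mul_apply, PiLp.inner_apply, mul_comm]
  refine ⟨O * R, ?_, ‖a'‖, hnorm, ?_⟩
  · rw [Matrix.transpose_mul, Matrix.mul_assoc, ← Matrix.mul_assoc Oᵀ,
      mul_eq_one_comm.1 hOO, Matrix.one_mul, hR]
  · have : Oᵀ *ᵥ Pi.single 0 1 = ‖a'‖⁻¹ • a := by
      ext j
      simp [hO, hb0, ha']
    rw [Matrix.transpose_mul, ← Matrix.mulVec_mulVec, this, Matrix.mulVec_smul, hRa, smul_smul,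
      mul_inv_cancel₀ hnorm, one_smul]

/-- The inverse of CᵗMC is C⁻¹M⁻¹C⁻ᵗ, and the outer factors cancel against the two copies of Cᵗ. -/
theorem dotProduct_inv_conj {n : ℕ} {C M : Matrix (Fin n) (Fin n) ℝ} (hC : IsUnit C.det)
    (u : Fin n → ℝ) :
    (Cᵀ *ᵥ u) ⬝ᵥ ((Cᵀ * M * C)⁻¹ *ᵥ (Cᵀ *ᵥ u)) = u ⬝ᵥ (M⁻¹ *ᵥ u) := by
  have hC' : IsUnit Cᵀ.det := by rwa [Matrix.det_transpose]
  rw [Matrix.mul_inv_rev, Matrix.mul_inv_rev, Matrix.mulVec_mulVec, Matrix.mul_assoc,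
    Matrix.mul_assoc, Matrix.nonsing_inv_mul _ hC', Matrix.mul_one, Matrix.dotProduct_mulVec,
    ← Matrix.mulVec_transpose, Matrix.transpose_mul, ← Matrix.mulVec_mulVec, Matrix.mulVec_mulVec u,
    ← Matrix.transpose_mul, Matrix.mul_nonsing_inv _ hC, Matrix.transpose_one, Matrix.one_mulVec,
    Matrix.mulVec_transpose, ← Matrix.dotProduct_mulVec]

/-! ### Reduction of the risk ratio to a Gram matrix. -/

/-- The matrix whose columns are the vectors `x j`. -/
def colMatrix {T n : ℕ} (x : Fin n → EuclideanSpace ℝ (Fin T)) : Matrix (Fin T) (Fin n) ℝ :=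
  Matrix.of fun t j => x j t

theorem colMatrix_mulVec_injective {T n : ℕ} {x : Fin n → EuclideanSpace ℝ (Fin T)}
    (hx : LinearIndependent ℝ x) : Function.Injective (colMatrix x).mulVec := by
  rw [Matrix.mulVec_injective_iff]
  exact hx.map' (WithLp.linearEquiv 2 ℝ (Fin T → ℝ)).toLinearMap (LinearEquiv.ker _)

theorem gram_posDef {T n : ℕ} {x : Fin n → EuclideanSpace ℝ (Fin T)}
    (hx : LinearIndependent ℝ x) : ((colMatrix x)ᵀ * colMatrix x).PosDef := by
  simpa using Matrix.PosDef.conjTranspose_mul_self _ (colMatrix_mulVec_injective hx)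

/-- The family of observations whose covariance factor is `C`, made from independent columns. -/
def observations {T n : ℕ} (C : Matrix (Fin n) (Fin n) ℝ) (x : Fin n → EuclideanSpace ℝ (Fin T)) :
    Fin T → EuclideanSpace ℝ (Fin n) :=
  fun t => WithLp.toLp 2 (Cᵀ *ᵥ fun j => x j t)

theorem dataMatrix_observations {T n : ℕ} (C : Matrix (Fin n) (Fin n) ℝ)
    (x : Fin n → EuclideanSpace ℝ (Fin T)) :
    dataMatrix (observations C x) = colMatrix x * C := by
  ext t j
  simp [dataMatrix, observations, colMatrix, Matrix.mulVec, dotProduct, Matrix.mul_apply, mul_comm]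

theorem estimator_observations {T n : ℕ} (C : Matrix (Fin n) (Fin n) ℝ)
    (x : Fin n → EuclideanSpace ℝ (Fin T)) :
    estimator 1 (observations C x) = (T : ℝ)⁻¹ • (Cᵀ * ((colMatrix x)ᵀ * colMatrix x) * C) := by
  simp [estimator_one, dataMatrix_observations, Matrix.mul_assoc]

theorem estimator_observations_posDef {T n : ℕ} (hT : 0 < T) {C : Matrix (Fin n) (Fin n) ℝ}
    (hC : IsUnit C.det) {x : Fin n → EuclideanSpace ℝ (Fin T)} (hx : LinearIndependent ℝ x) :
    (estimator 1 (observations C x)).PosDef := by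
  rw [estimator_observations]
  refine Matrix.PosDef.smul ?_ (by positivity)
  simpa using (gram_posDef hx).conjTranspose_mul_mul_same
    (Matrix.mulVec_injective_of_isUnit ((Matrix.isUnit_iff_isUnit_det _).2 hC))

/-- Since 1 = c·Cᵗe₀, both quadratic forms 1ᵗM⁻¹1 lose C by `dotProduct_inv_conj` and carry the same
factor c². The factor T is the normalization of the estimator. -/
theorem riskRatio_observations {T k : ℕ} (hT : 0 < T)
    {S C : Matrix (Fin (k + 1)) (Fin (k + 1)) ℝ} (hS : S.PosDef) (hCS : Cᵀ * C = S)
    {c : ℝ} (hc : c ≠ 0) (hC1 : (1 : Fin (k + 1) → ℝ) = c • (Cᵀ *ᵥ Pi.single 0 1))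
    {x : Fin (k + 1) → EuclideanSpace ℝ (Fin T)} (hx : LinearIndependent ℝ x) :
    riskRatio S 1 (observations C x) = T * ((colMatrix x)ᵀ * colMatrix x)⁻¹ 0 0 := by
  have hC : IsUnit C.det := by
    have h1 : IsUnit S.det := (Matrix.isUnit_iff_isUnit_det _).1 hS.isUnit
    rw [← hCS, Matrix.det_mul] at h1
    exact isUnit_of_mul_isUnit_right h1
  have hT' : (T : ℝ) ≠ 0 := by positivity
  have hs : 1 ⬝ᵥ (S⁻¹ *ᵥ 1) = c ^ 2 := by
    have := dotProduct_inv_conj (M := 1) hC (Pi.single 0 1)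
    rw [Matrix.mul_one, hCS] at this
    rw [hC1, Matrix.mulVec_smul, smul_dotProduct, dotProduct_smul, this]
    simp [sq]
  have he : 1 ⬝ᵥ ((estimator 1 (observations C x))⁻¹ *ᵥ 1) =
      c ^ 2 * (T * ((colMatrix x)ᵀ * colMatrix x)⁻¹ 0 0) := by
    have hdet : IsUnit (Cᵀ * ((colMatrix x)ᵀ * colMatrix x) * C).det := by
      have := (Matrix.isUnit_iff_isUnit_det _).1 (gram_posDef hx).isUnit
      rw [Matrix.det_mul, Matrix.det_mul, Matrix.det_transpose]
      exact (hC.mul this).mul hC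
    have hinv : ((T : ℝ)⁻¹ • (Cᵀ * ((colMatrix x)ᵀ * colMatrix x) * C))⁻¹ =
        (T : ℝ) • (Cᵀ * ((colMatrix x)ᵀ * colMatrix x) * C)⁻¹ := by
      refine Matrix.inv_eq_left_inv ?_
      rw [smul_mul_smul_comm, mul_inv_cancel₀ hT', one_smul, Matrix.nonsing_inv_mul _ hdet]
    rw [estimator_observations, hinv, hC1, Matrix.mulVec_smul, smul_dotProduct, dotProduct_smul,
      Matrix.smul_mulVec, dotProduct_smul, dotProduct_inv_conj hC]
    simp
    ring
  rw [riskRatio, risk_sq hS, risk_sq (estimator_observations_posDef hT hC hx), hs, he]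
  field_simp

/-- The first diagonal entry of the inverse Gram matrix is the reciprocal squared distance of the
first vector to the span of the others. -/
theorem inv_gram_zero_zero {T k : ℕ} {x : Fin (k + 1) → EuclideanSpace ℝ (Fin T)}
    (hx : LinearIndependent ℝ x) :
    ((colMatrix x)ᵀ * colMatrix x)⁻¹ 0 0 =
      (‖(Submodule.span ℝ (Set.range (Fin.tail x)))ᗮ.orthogonalProjectionOnto (x 0)‖ ^ 2)⁻¹ := by
  set V := Submodule.span ℝ (Set.range (Fin.tail x))
  obtain ⟨c, hc⟩ : ∃ c : Fin k → ℝ, ∑ i, c i • Fin.tail x i = V.starProjection (x 0) :=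
    (Submodule.mem_span_range_iff_exists_fun ℝ).1 (V.starProjection_apply_mem (x 0))
  set v := Vᗮ.starProjection (x 0) with hv
  have hvmem : v ∈ Vᗮ := Vᗮ.starProjection_apply_mem (x 0)
  have hsum : V.starProjection (x 0) + v = x 0 := V.starProjection_add_starProjection_orthogonal _
  -- `g` holds the coefficients of the residual v in terms of the x j. As v is orthogonal to every x
  -- j with j ≠ 0, the Gram matrix sends g to ‖v‖²e₀; inverting and reading entry 0, where g is 1,
  -- gives the claim.
  set g : Fin (k + 1) → ℝ := Fin.cons 1 (fun i => - c i) with hg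
  have hXg : ∀ t, (colMatrix x *ᵥ g) t = v t := by
    intro t
    have h : v = x 0 - ∑ i, c i • Fin.tail x i := by
      rw [hc]; exact eq_sub_of_add_eq' hsum
    rw [h]
    simp [colMatrix, Matrix.mulVec, dotProduct, Fin.sum_univ_succ, hg, Fin.tail, mul_comm,
      sub_eq_add_neg]
  have hXv : ((colMatrix x)ᵀ * colMatrix x) *ᵥ g = ‖v‖ ^ 2 • Pi.single 0 1 := by
    rw [← Matrix.mulVec_mulVec]
    ext j
    have h1 : ((colMatrix x)ᵀ *ᵥ (colMatrix x *ᵥ g)) j = inner ℝ (x j) v := by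
      rw [show colMatrix x *ᵥ g = v from funext hXg]
      simp [Matrix.mulVec, dotProduct, colMatrix, PiLp.inner_apply, mul_comm]
    rw [h1]
    refine Fin.cases ?_ (fun i => ?_) j
    · rw [← hsum, inner_add_left,
        Submodule.inner_right_of_mem_orthogonal (V.starProjection_apply_mem (x 0)) hvmem]
      simp
    · rw [Submodule.inner_right_of_mem_orthogonal 
        (Submodule.subset_span (Set.mem_range_self (f := Fin.tail x) i) : x i.succ ∈ V) hvmem]
      simp
  have hdet := (Matrix.isUnit_iff_isUnit_det _).1 (gram_posDef hx).isUnit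
  have h0 : g = ‖v‖ ^ 2 • (((colMatrix x)ᵀ * colMatrix x)⁻¹ *ᵥ Pi.single 0 1) := by
    rw [← Matrix.mulVec_smul, ← hXv, Matrix.mulVec_mulVec, Matrix.nonsing_inv_mul _ hdet,
      Matrix.one_mulVec]
  have h00 := congrFun h0 0
  have hnv : ‖Vᗮ.orthogonalProjectionOnto (x 0)‖ = ‖v‖ := by
    rw [hv, Submodule.starProjection_apply, Submodule.coe_norm]
  rw [hnv]
  simp [hg] at h00
  exact eq_inv_of_mul_eq_one_right h00.symm

/-! ### Standard Gaussian vectors: null subspaces, projections, inverse moments. -/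

section Gaussian

variable {E : Type*} [NormedAddCommGroup E] [InnerProductSpace ℝ E] [FiniteDimensional ℝ E]
  [MeasurableSpace E] [BorelSpace E]

/-- A nonzero v orthogonal to V gives a functional vanishing on V whose law is a nondegenerate real
Gaussian, hence without atoms. -/
theorem stdGaussian_submodule_eq_zero {V : Submodule ℝ E} (hV : V ≠ ⊤) :
    stdGaussian E (V : Set E) = 0 := by
  obtain ⟨v, hv, hv0⟩ := Submodule.exists_mem_ne_zero_of_ne_bot
    (mt Submodule.orthogonal_eq_bot_iff.1 hV)
  have hmap : (stdGaussian E).map (innerSL ℝ v) = gaussianReal 0 (‖v‖ ^ 2).toNNReal := by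
    rw [IsGaussian.map_eq_gaussianReal, integral_strongDual_stdGaussian,
      variance_dual_stdGaussian, innerSL_apply_norm]
  have hne : (‖v‖ ^ 2).toNNReal ≠ 0 := by simpa using hv0
  have := nullSingletonClass_gaussianReal (μ := 0) hne
  refine measure_mono_null (t := innerSL ℝ v ⁻¹' {0}) (fun x hx => ?_) ?_
  · simpa using Submodule.inner_left_of_mem_orthogonal hx hv
  · rw [← Measure.map_apply (by fun_prop) (measurableSet_singleton 0), hmap]
    exact measure_singleton 0

theorem ae_notMem_submodule_stdGaussian {V : Submodule ℝ E} (hV : V ≠ ⊤) :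
    ∀ᵐ x ∂stdGaussian E, x ∉ V :=
  measure_eq_zero_iff_ae_notMem.1 (stdGaussian_submodule_eq_zero hV)

theorem ae_linearIndependent_stdGaussian (n : ℕ) (hn : n ≤ Module.finrank ℝ E) :
    ∀ᵐ x ∂Measure.pi (fun _ : Fin n => stdGaussian E), LinearIndependent ℝ x := by
  induction n with
  | zero => exact .of_forall fun x => linearIndependent_empty_type
  | succ n ih =>
    have hmeas : MeasurableSet {x : Fin (n + 1) → E | LinearIndependent ℝ x} :=
      isOpen_setOfPred_linearIndependent.measurableSet
    have hmp := (measurePreserving_piFinSuccAbove (fun _ : Fin (n + 1) => stdGaussian E) 0).symm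
    rw [← hmp.map_eq, ae_map_iff hmp.measurable.aemeasurable hmeas]
    have hp : MeasurableSet {z : E × (Fin n → E) |
        LinearIndependent ℝ ((MeasurableEquiv.piFinSuccAbove (fun _ => E) 0).symm z)} :=
      hmp.measurable hmeas
    rw [Measure.ae_prod_iff_ae_ae hp, Measure.ae_ae_comm hp]
    filter_upwards [ih (by omega)] with r hr
    have hspan : Submodule.span ℝ (Set.range r) ≠ ⊤ := by
      intro h
      have h1 := finrank_range_le_card (R := ℝ) r
      rw [Set.finrank, h, finrank_top, Fintype.card_fin] at h1
      omega
    filter_upwards [ae_notMem_submodule_stdGaussian hspan] with z hz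
    have : (MeasurableEquiv.piFinSuccAbove (fun _ : Fin (n + 1) => E) 0).symm (z, r) =
        Fin.cons z r := by
      simp [Fin.consEquiv]
    rw [this]
    exact linearIndependent_finCons.2 ⟨hr, hz⟩

/-- Orthogonal projections preserve standard Gaussian measures. -/
theorem map_orthogonalProjectionOnto_stdGaussian (K : Submodule ℝ E) :
    (stdGaussian E).map K.orthogonalProjectionOnto = stdGaussian K := by
  have : IsProbabilityMeasure ((stdGaussian E).map K.orthogonalProjectionOnto) :=
    Measure.isProbabilityMeasure_map (by fun_prop)
  apply Measure.ext_of_charFun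
  ext t
  rw [charFun_stdGaussian, charFun_apply, integral_map (by fun_prop)
    (Measurable.aestronglyMeasurable (by fun_prop))]
  simp_rw [Submodule.inner_orthogonalProjectionOnto_eq_of_mem_right]
  rw [← charFun_apply, charFun_stdGaussian, Submodule.coe_norm]

theorem integral_exp_neg_mul_sq_gaussianReal {s : ℝ} (hs : 0 ≤ s) :
    ∫ x, Real.exp (-(s * x ^ 2)) ∂gaussianReal 0 1 = (1 + 2 * s) ^ (-(1 / 2) : ℝ) := by
  rw [integral_gaussianReal_eq_integral_smul (by simp)]
  have h (x : ℝ) : gaussianPDFReal 0 1 x • Real.exp (-(s * x ^ 2)) =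
      (√(2 * Real.pi))⁻¹ * Real.exp (-(1 / 2 + s) * x ^ 2) := by
    simp only [gaussianPDFReal, smul_eq_mul, mul_assoc, ← Real.exp_add]
    rw [NNReal.coe_one]
    congr 2
    · ring_nf
    · ring
  simp_rw [h]
  rw [integral_const_mul, integral_gaussian, ← Real.sqrt_inv, ← Real.sqrt_mul (by positivity),
    Real.rpow_neg (by positivity), ← Real.sqrt_eq_rpow, ← Real.sqrt_inv]
  congr 1
  field_simp

theorem integral_exp_neg_mul_norm_sq_stdGaussian {s : ℝ} (hs : 0 ≤ s) :
    ∫ x, Real.exp (-(s * ‖x‖ ^ 2)) ∂stdGaussian E =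
      (1 + 2 * s) ^ (-(Module.finrank ℝ E / 2) : ℝ) := by
  rw [stdGaussian, integral_map (Measurable.aemeasurable (by fun_prop))
    (Measurable.aestronglyMeasurable (by fun_prop))]
  have h (x : Fin (Module.finrank ℝ E) → ℝ) :
      Real.exp (-(s * ‖∑ i, x i • stdOrthonormalBasis ℝ E i‖ ^ 2)) =
        ∏ i, Real.exp (-(s * x i ^ 2)) := by
    rw [← Real.exp_sum, ← (stdOrthonormalBasis ℝ E).sum_sq_norm_inner_right]
    simp [(stdOrthonormalBasis ℝ E).orthonormal.inner_right_fintype, Finset.mul_sum]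
  simp_rw [h]
  rw [integral_fintype_prod_eq_prod (f := fun _ y => Real.exp (-(s * y ^ 2)))]
  simp_rw [integral_exp_neg_mul_sq_gaussianReal hs]
  rw [Finset.prod_const, ← Real.rpow_mul_natCast (by positivity)]
  simp
  ring_nf

theorem lintegral_exp_neg_mul_norm_sq_stdGaussian {s : ℝ} (hs : 0 ≤ s) :
    ∫⁻ x, ENNReal.ofReal (Real.exp (-(s * ‖x‖ ^ 2))) ∂stdGaussian E =
      ENNReal.ofReal ((1 + 2 * s) ^ (-(Module.finrank ℝ E / 2) : ℝ)) := by
  rw [← integral_exp_neg_mul_norm_sq_stdGaussian hs, ofReal_integral_eq_lintegral_ofReal]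
  · refine Integrable.of_bound (Measurable.aestronglyMeasurable (by fun_prop)) 1
      (.of_forall fun x => ?_)
    rw [Real.norm_of_nonneg (Real.exp_nonneg _), Real.exp_le_one_iff]
    have := sq_nonneg ‖x‖
    nlinarith [mul_nonneg hs this]
  · exact .of_forall fun x => Real.exp_nonneg _

/-- Inverse moments of the norm of a standard Gaussian vector, through Laplace transforms. -/
theorem lintegral_norm_sq_inv_pow_mul_factorial (hE : 0 < Module.finrank ℝ E) (p : ℕ) :
    ∫⁻ x, ENNReal.ofReal (p.factorial * ((‖x‖ ^ 2)⁻¹) ^ (p + 1)) ∂stdGaussian E =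
      ∫⁻ s in Set.Ioi 0,
        ENNReal.ofReal (s ^ p * (1 + 2 * s) ^ (-(Module.finrank ℝ E / 2) : ℝ)) := by
  have hne : ∀ᵐ x ∂stdGaussian E, x ≠ 0 := by
    have h : (⊥ : Submodule ℝ E) ≠ ⊤ := fun h => by
      have := finrank_top ℝ E
      rw [← h, finrank_bot] at this
      omega
    simpa using ae_notMem_submodule_stdGaussian h
  -- Gamma integral: p!/r^(p+1) = ∫ s^p e^(-sr) ds over s > 0, with r = ‖x‖². Tonelli then needs no
  -- prior integrability.
  have h1 : ∀ᵐ x ∂stdGaussian E, ENNReal.ofReal (p.factorial * ((‖x‖ ^ 2)⁻¹) ^ (p + 1)) =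
      ∫⁻ s in Set.Ioi (0 : ℝ),
        ENNReal.ofReal (s ^ p) * ENNReal.ofReal (Real.exp (-(s * ‖x‖ ^ 2))) := by
    filter_upwards [hne] with x hx
    have hr : 0 < ‖x‖ ^ 2 := by have := norm_pos_iff.2 hx; positivity
    have key := Real.integral_rpow_mul_exp_neg_mul_Ioi (a := p + 1) (by positivity) hr
    simp only [add_sub_cancel_right, Real.rpow_natCast, Real.Gamma_nat_eq_factorial] at key
    have hval : (1 / ‖x‖ ^ 2) ^ ((p : ℝ) + 1) * p.factorial =
        p.factorial * ((‖x‖ ^ 2)⁻¹) ^ (p + 1) := by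
      rw [mul_comm, one_div]
      norm_cast
    rw [← hval, ← key, ofReal_integral_eq_lintegral_ofReal]
    · refine setLIntegral_congr_fun measurableSet_Ioi fun s hs => ?_
      have hs : 0 < s := hs
      rw [ENNReal.ofReal_mul (by positivity), mul_comm s]
    · refine Integrable.of_integral_ne_zero ?_
      rw [key]
      positivity
    · filter_upwards [ae_restrict_mem measurableSet_Ioi] with s hs
      have hs : 0 < s := hs
      simp only [Pi.zero_apply]
      positivity
  rw [lintegral_congr_ae h1, lintegral_lintegral_swap (by fun_prop)]
  refine setLIntegral_congr_fun measurableSet_Ioi fun s hs => ?_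
  have hs : 0 < s := hs
  rw [lintegral_const_mul _ (by fun_prop), lintegral_exp_neg_mul_norm_sq_stdGaussian hs.le,
    ENNReal.ofReal_mul (by positivity)]

end Gaussian

/-! ### Explicit integrals of the Laplace transform. -/

theorem lintegral_Ioi_of_hasDerivAt {g g' : ℝ → ℝ} {a l : ℝ}
    (hderiv : ∀ x ∈ Set.Ici a, HasDerivAt g (g' x) x) (hpos : ∀ x ∈ Set.Ioi a, 0 ≤ g' x)
    (hg : Filter.Tendsto g Filter.atTop (nhds l)) :
    ∫⁻ x in Set.Ioi a, ENNReal.ofReal (g' x) = ENNReal.ofReal (l - g a) := by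
  rw [← integral_Ioi_of_hasDerivAt_of_nonneg' hderiv hpos hg, ofReal_integral_eq_lintegral_ofReal]
  · exact integrableOn_Ioi_deriv_of_nonneg' hderiv hpos hg
  · filter_upwards [ae_restrict_mem measurableSet_Ioi] with s hs using hpos s hs

theorem tendsto_one_add_two_mul_rpow_neg {a : ℝ} (ha : 0 < a) :
    Filter.Tendsto (fun s : ℝ => (1 + 2 * s) ^ (-a)) Filter.atTop (nhds 0) :=
  (tendsto_rpow_neg_atTop ha).comp (Filter.tendsto_atTop_add_const_left _ _
    (Filter.tendsto_id.const_mul_atTop two_pos))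

theorem hasDerivAt_one_add_two_mul_rpow (a : ℝ) {s : ℝ} (hs : 0 ≤ s) :
    HasDerivAt (fun s : ℝ => (1 + 2 * s) ^ a) (2 * a * (1 + 2 * s) ^ (a - 1)) s := by
  have h : HasDerivAt (fun s : ℝ => 1 + 2 * s) 2 s := by
    simpa using ((hasDerivAt_id s).const_mul 2).const_add 1
  have := h.rpow_const (p := a) (Or.inl (by positivity))
  convert this using 1

theorem lintegral_one_add_two_mul_rpow {m : ℝ} (hm : 2 < m) :
    ∫⁻ s in Set.Ioi 0, ENNReal.ofReal ((1 + 2 * s) ^ (-(m / 2))) =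
      ENNReal.ofReal (1 / (m - 2)) := by
  have hm' : m - 2 ≠ 0 := by linarith
  rw [lintegral_Ioi_of_hasDerivAt (g := fun s => -(1 / (m - 2)) * (1 + 2 * s) ^ (-(m / 2 - 1)))
    (l := -(1 / (m - 2)) * 0)]
  · simp
  · intro s hs
    refine ((hasDerivAt_one_add_two_mul_rpow (-(m / 2 - 1)) hs).const_mul
      (-(1 / (m - 2)))).congr_deriv ?_
    rw [show -(m / 2 - 1) - 1 = -(m / 2) by ring]
    field_simp
  · intro s hs
    have hs : 0 < s := hs
    positivity
  · exact (tendsto_one_add_two_mul_rpow_neg (by linarith)).const_mul _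

theorem lintegral_mul_one_add_two_mul_rpow {m : ℝ} (hm : 4 < m) :
    ∫⁻ s in Set.Ioi 0, ENNReal.ofReal (s * (1 + 2 * s) ^ (-(m / 2))) =
      ENNReal.ofReal (1 / ((m - 2) * (m - 4))) := by
  have hm2 : m - 2 ≠ 0 := by linarith
  have hm4 : m - 4 ≠ 0 := by linarith
  -- The antiderivative comes from writing s = ((1 + 2s) - 1)/2 and integrating the two powers
  -- separately.
  rw [lintegral_Ioi_of_hasDerivAt (g := fun s =>
      -(1 / (2 * (m - 4))) * (1 + 2 * s) ^ (-(m / 2 - 2)) +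
        (1 / (2 * (m - 2))) * (1 + 2 * s) ^ (-(m / 2 - 1)))
    (l := -(1 / (2 * (m - 4))) * 0 + (1 / (2 * (m - 2))) * 0)]
  · congr 1
    simp
    field_simp
    ring
  · intro s hs
    have hs : 0 ≤ s := hs
    refine (((hasDerivAt_one_add_two_mul_rpow (-(m / 2 - 2)) hs).const_mul
      (-(1 / (2 * (m - 4))))).add ((hasDerivAt_one_add_two_mul_rpow (-(m / 2 - 1)) hs).const_mul
      (1 / (2 * (m - 2))))).congr_deriv ?_
    rw [show -(m / 2 - 1) - 1 = -(m / 2) by ring, show -(m / 2 - 2) - 1 = -(m / 2) + 1 by ring,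
      Real.rpow_add_one (by positivity)]
    field_simp
    ring
  · intro s hs
    have hs : 0 < s := hs
    positivity
  · exact ((tendsto_one_add_two_mul_rpow_neg (by linarith)).const_mul _).add
      ((tendsto_one_add_two_mul_rpow_neg (by linarith)).const_mul _)

/-! ### Law of the observations. -/

/-- A centered Gaussian vector is a linear image of a standard one, for any factorization of its
covariance matrix. -/
theorem multivariateGaussian_eq_map {n : ℕ} {S C : Matrix (Fin n) (Fin n) ℝ} (hCS : Cᵀ * C = S) :
    multivariateGaussian 0 S = (Measure.pi fun _ : Fin n => gaussianReal 0 1).map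
      (fun z => WithLp.toLp 2 (Cᵀ *ᵥ z)) := by
  have hS : S.PosSemidef := by
    simpa [← hCS] using Matrix.posSemidef_conjTranspose_mul_self C
  have hcomp : (fun z : Fin n → ℝ => WithLp.toLp 2 (Cᵀ *ᵥ z)) =
      (fun x : EuclideanSpace ℝ (Fin n) => WithLp.toLp 2 (Cᵀ *ᵥ x.ofLp)) ∘ WithLp.toLp 2 := rfl
  have hmeas : Measurable (fun x : EuclideanSpace ℝ (Fin n) => WithLp.toLp 2 (Cᵀ *ᵥ x.ofLp)) := by
    fun_prop
  rw [hcomp, ← Measure.map_map hmeas (by fun_prop), map_pi_eq_stdGaussian]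
  have : IsProbabilityMeasure ((stdGaussian (EuclideanSpace ℝ (Fin n))).map
      (fun x : EuclideanSpace ℝ (Fin n) => WithLp.toLp 2 (Cᵀ *ᵥ x.ofLp))) :=
    Measure.isProbabilityMeasure_map hmeas.aemeasurable
  apply Measure.ext_of_charFun
  ext t
  rw [charFun_multivariateGaussian hS, charFun_apply, integral_map hmeas.aemeasurable
    (Measurable.aestronglyMeasurable (by fun_prop))]
  have hinner (x : EuclideanSpace ℝ (Fin n)) :
      inner ℝ (WithLp.toLp 2 (Cᵀ *ᵥ x.ofLp) : EuclideanSpace ℝ (Fin n)) t =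
        inner ℝ x (WithLp.toLp 2 (C *ᵥ t.ofLp)) := by
    simp only [EuclideanSpace.inner_eq_star_dotProduct, star_trivial]
    rw [Matrix.mulVec_transpose, dotProduct_comm, ← Matrix.dotProduct_mulVec, dotProduct_comm]
  simp_rw [hinner]
  rw [← charFun_apply, charFun_stdGaussian]
  have hnorm : ‖(WithLp.toLp 2 (C *ᵥ t.ofLp) : EuclideanSpace ℝ (Fin n))‖ ^ 2 =
      t.ofLp ⬝ᵥ S *ᵥ t.ofLp := by
    rw [← real_inner_self_eq_norm_sq, EuclideanSpace.inner_eq_star_dotProduct, ← hCS,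
      ← Matrix.mulVec_mulVec, Matrix.dotProduct_mulVec t.ofLp, Matrix.vecMul_transpose]
    simp
  rw [← hnorm]
  simp [neg_div]

/-- Both sides are curryings of one product measure over index pairs. This passes from independent
rows to independent columns of the data matrix. -/
theorem pi_pi_eq_map_swap {ι κ X : Type*} [Fintype ι] [Fintype κ] [MeasurableSpace X]
    (μ : Measure X) [IsProbabilityMeasure μ] :
    (Measure.pi fun _ : ι => Measure.pi fun _ : κ => μ) =
      (Measure.pi fun _ : κ => Measure.pi fun _ : ι => μ).map (fun x i j => x j i) := by
  have h1 := Measure.infinitePi_map_curry (fun (_ : ι) (_ : κ) => μ)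
  have h2 := Measure.infinitePi_map_curry (fun (_ : κ) (_ : ι) => μ)
  simp only [Measure.infinitePi_eq_pi] at h1 h2
  have hs := (measurePreserving_piCongrLeft (fun _ : ι × κ => μ) (Equiv.prodComm κ ι)).map_eq
  rw [← h1, ← h2, ← hs, Measure.map_map (by fun_prop) (by fun_prop),
    Measure.map_map (by fun_prop) (by fun_prop)]
  rfl

theorem measurable_observations {T n : ℕ} (C : Matrix (Fin n) (Fin n) ℝ) :
    Measurable (observations (T := T) C) := by
  unfold observations
  fun_prop

theorem map_observations {T n : ℕ} {S C : Matrix (Fin n) (Fin n) ℝ} (hCS : Cᵀ * C = S) :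
    (Measure.pi fun _ : Fin n => stdGaussian (EuclideanSpace ℝ (Fin T))).map (observations C) =
      Measure.pi fun _ : Fin T => multivariateGaussian 0 S := by
  have hL : Measurable (fun z : Fin n → ℝ =>
      (WithLp.toLp 2 (Cᵀ *ᵥ z) : EuclideanSpace ℝ (Fin n))) := by fun_prop
  have h1 : (Measure.pi fun _ : Fin n => stdGaussian (EuclideanSpace ℝ (Fin T))) =
      (Measure.pi fun _ : Fin n => Measure.pi fun _ : Fin T => gaussianReal 0 1).map
        (fun z j => WithLp.toLp 2 (z j)) := by
    have : IsProbabilityMeasure ((Measure.pi fun _ : Fin T => gaussianReal 0 1).map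
      (WithLp.toLp 2)) := Measure.isProbabilityMeasure_map (by fun_prop)
    rw [Measure.pi_map_pi (fun _ => by fun_prop), map_pi_eq_stdGaussian]
  have h2 : (Measure.pi fun _ : Fin T => multivariateGaussian 0 S) =
      (Measure.pi fun _ : Fin T => Measure.pi fun _ : Fin n => gaussianReal 0 1).map
        (fun z t => WithLp.toLp 2 (Cᵀ *ᵥ z t)) := by
    have : IsProbabilityMeasure ((Measure.pi fun _ : Fin n => gaussianReal 0 1).map
      (fun z : Fin n → ℝ => (WithLp.toLp 2 (Cᵀ *ᵥ z) : EuclideanSpace ℝ (Fin n)))) :=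
      Measure.isProbabilityMeasure_map hL.aemeasurable
    rw [Measure.pi_map_pi (fun _ => hL.aemeasurable), ← multivariateGaussian_eq_map hCS]
  rw [h1, h2, pi_pi_eq_map_swap (ι := Fin T), Measure.map_map (measurable_observations C)
    (by fun_prop), Measure.map_map (by fun_prop) (by fun_prop)]
  rfl

/-! ### Measurability of the risk and of its ratio. -/

section Measurability

variable {α : Type*} [TopologicalSpace α] [MeasurableSpace α] [BorelSpace α] {n : ℕ}
  {M : α → Matrix (Fin n) (Fin n) ℝ}

theorem measurable_inv_apply (hM : Continuous M) (i j : Fin n) :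
    Measurable fun a => (M a)⁻¹ i j := by
  have : (fun a => (M a)⁻¹ i j) = fun a => (M a).det⁻¹ * (M a).adjugate i j := by
    ext a
    simp [Matrix.inv_def]
  rw [this]
  exact hM.matrix_det.measurable.inv.mul (hM.matrix_adjugate.matrix_elem i j).measurable

theorem measurable_weights_apply (hM : Continuous M) (i : Fin n) :
    Measurable fun a => weights (M a) i :=
  (Finset.measurable_fun_sum _ fun j _ => measurable_inv_apply hM i j).div
    (Finset.measurable_fun_sum _ fun j _ => Finset.measurable_fun_sum _ fun k _ =>
      measurable_inv_apply hM j k)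

theorem measurable_risk (hM : Continuous M) : Measurable fun a => risk (M a) := by
  have hw := measurable_weights_apply hM
  have hM' (i j : Fin n) : Measurable fun a => M a i j := (hM.matrix_elem i j).measurable
  simp only [risk, dotProduct, Matrix.mulVec]
  fun_prop

end Measurability

theorem continuous_estimator {T n : ℕ} (B : Matrix (Fin T) (Fin T) ℝ) :
    Continuous (estimator (n := n) B) := by
  unfold estimator dataMatrix
  fun_prop

theorem measurable_riskRatio {T n : ℕ} (S : Matrix (Fin n) (Fin n) ℝ)
    (B : Matrix (Fin T) (Fin T) ℝ) : Measurable (riskRatio S B) :=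
  ((measurable_risk (continuous_estimator B)).pow_const 2).const_div _

theorem measurableSet_estimator_one_posDef (T n : ℕ) :
    MeasurableSet {y : Fin T → EuclideanSpace ℝ (Fin n) | (estimator 1 y).PosDef} := by
  -- The estimator is always positive semidefinite, so definiteness reduces to a determinant
  -- condition.
  have h (y : Fin T → EuclideanSpace ℝ (Fin n)) :
      (estimator 1 y).PosDef ↔ (estimator 1 y).det ≠ 0 := by
    refine Matrix.PosSemidef.posDef_iff_det_ne_zero ?_
    rw [estimator_one]
    refine Matrix.PosSemidef.smul ?_ (by positivity)
    simpa using Matrix.posSemidef_conjTranspose_mul_self (dataMatrix y)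
  simp_rw [h]
  exact (continuous_estimator 1).matrix_det.measurable (measurableSet_singleton 0).compl

theorem measurable_inv_gram {T n : ℕ} (i j : Fin n) :
    Measurable fun x : Fin n → EuclideanSpace ℝ (Fin T) =>
      ((colMatrix x)ᵀ * colMatrix x)⁻¹ i j := by
  refine measurable_inv_apply ?_ i j
  unfold colMatrix
  fun_prop

/-! ### Moments of the inverse Gram entry. -/

/-- Moments of the first diagonal entry of an inverse Wishart matrix. -/
theorem lintegral_inv_gram_pow {T k : ℕ} (hk : k + 1 ≤ T) (p : ℕ) :
    ∫⁻ x, ENNReal.ofReal (p.factorial * (((colMatrix x)ᵀ * colMatrix x)⁻¹ 0 0) ^ (p + 1))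
        ∂Measure.pi (fun _ : Fin (k + 1) => stdGaussian (EuclideanSpace ℝ (Fin T))) =
      ∫⁻ s in Set.Ioi 0, ENNReal.ofReal (s ^ p * (1 + 2 * s) ^ (-(((T : ℝ) - k) / 2))) := by
  set E := EuclideanSpace ℝ (Fin T)
  have hrank : k + 1 ≤ Module.finrank ℝ E := 
    hk.trans_eq finrank_euclideanSpace_fin.symm
  have hmp := (measurePreserving_piFinSuccAbove (fun _ : Fin (k + 1) => stdGaussian E) 0).symm
  set F : (Fin (k + 1) → E) → ℝ≥0∞ := fun x =>
    ENNReal.ofReal (p.factorial * (((colMatrix x)ᵀ * colMatrix x)⁻¹ 0 0) ^ (p + 1)) with hF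
  have hFm : Measurable F := (((measurable_inv_gram 0 0).pow_const _).const_mul _).ennreal_ofReal
  have hLI := ae_linearIndependent_stdGaussian (E := E) (k + 1) hrank
  have hmeas : MeasurableSet {x : Fin (k + 1) → E | LinearIndependent ℝ x} :=
    isOpen_setOfPred_linearIndependent.measurableSet
  have hp : MeasurableSet {z : E × (Fin k → E) |
      LinearIndependent ℝ ((MeasurableEquiv.piFinSuccAbove (fun _ => E) 0).symm z)} :=
    hmp.measurable hmeas
  rw [← hmp.map_eq, ae_map_iff hmp.measurable.aemeasurable hmeas,
    Measure.ae_prod_iff_ae_ae hp, Measure.ae_ae_comm hp] at hLI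
  rw [← hmp.lintegral_comp hFm, lintegral_prod_symm'
    (fun z => F ((MeasurableEquiv.piFinSuccAbove (fun _ => E) 0).symm z)) (hFm.comp hmp.measurable)]
  have hcons (z : E) (r : Fin k → E) :
      (MeasurableEquiv.piFinSuccAbove (fun _ : Fin (k + 1) => E) 0).symm (z, r) =
        Fin.cons z r := by
    simp [Fin.consEquiv]
  simp_rw [hcons] at hLI
  simp_rw [hcons]
  -- The inner integral over the first column depends on the other columns `r` only through dim Vᗮ =
  -- T - k, so it is almost surely constant.
  have hinner : ∀ᵐ r ∂Measure.pi (fun _ : Fin k => stdGaussian E),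
      ∫⁻ z, F (Fin.cons z r) ∂stdGaussian E =
        ∫⁻ s in Set.Ioi 0, ENNReal.ofReal (s ^ p * (1 + 2 * s) ^ (-(((T : ℝ) - k) / 2))) := by
    filter_upwards [hLI, ae_linearIndependent_stdGaussian (E := E) k (by omega)] with r hr hrLI
    set V := Submodule.span ℝ (Set.range r)
    have hVr : Module.finrank ℝ V = k := by
      simpa using finrank_span_eq_card hrLI
    have hVo : Module.finrank ℝ Vᗮ + k = T := by
      have := V.finrank_add_finrank_orthogonal
      rw [hVr, finrank_euclideanSpace_fin] at this
      omega
    have h1 : ∀ᵐ z ∂stdGaussian E, F (Fin.cons z r) =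
        ENNReal.ofReal
          (p.factorial * ((‖Vᗮ.orthogonalProjectionOnto z‖ ^ 2)⁻¹) ^ (p + 1)) := by
      filter_upwards [hr] with z hz
      have := inv_gram_zero_zero hz
      rw [Fin.cons_zero, Fin.tail_cons] at this
      simp only [hF, this]
      rfl
    rw [lintegral_congr_ae h1, ← lintegral_map (μ := stdGaussian E)
      (f := fun y : Vᗮ => ENNReal.ofReal (p.factorial * ((‖y‖ ^ 2)⁻¹) ^ (p + 1)))
      (by fun_prop) (by fun_prop),
      map_orthogonalProjectionOnto_stdGaussian,
      lintegral_norm_sq_inv_pow_mul_factorial (by omega)]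
    have : (Module.finrank ℝ Vᗮ : ℝ) = T - k := by
      have h := congrArg (Nat.cast (R := ℝ)) hVo
      push_cast at h
      linarith
    rw [this]
  rw [lintegral_congr_ae hinner]
  simp

theorem memLp_two_and_variance_of_lintegral {Ω : Type*} [MeasurableSpace Ω] {μ : Measure Ω}
    [IsProbabilityMeasure μ] {f : Ω → ℝ} (hf : Measurable f) (hf0 : 0 ≤ᵐ[μ] f) {a b : ℝ}
    (ha : 0 ≤ a) (hb : 0 ≤ b) (h1 : ∫⁻ x, ENNReal.ofReal (f x) ∂μ = ENNReal.ofReal a)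
    (h2 : ∫⁻ x, ENNReal.ofReal (f x ^ 2) ∂μ = ENNReal.ofReal b) :
    MemLp f 2 μ ∧ Var[f; μ] = b - a ^ 2 := by
  have hint : Integrable (fun x => f x ^ 2) μ :=
    (lintegral_ofReal_ne_top_iff_integrable (by fun_prop)
      (.of_forall fun x => sq_nonneg (f x))).1 (by simp [h2])
  have hmem : MemLp f 2 μ := (memLp_two_iff_integrable_sq hf.aestronglyMeasurable).2 hint
  refine ⟨hmem, ?_⟩
  rw [variance_eq_sub hmem]
  simp only [Pi.pow_apply]
  rw [integral_eq_lintegral_of_nonneg_ae hf0 hf.aestronglyMeasurable, h1,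
    ENNReal.toReal_ofReal ha, integral_eq_lintegral_of_nonneg_ae
      (.of_forall fun x => sq_nonneg (f x)) (by fun_prop), h2, ENNReal.toReal_ofReal hb]

theorem memLp_two_and_variance_inv_gram {T k : ℕ} (hk : k + 4 < T) :
    MemLp (fun x => ((colMatrix x)ᵀ * colMatrix x)⁻¹ 0 0) 2
        (Measure.pi (fun _ : Fin (k + 1) => stdGaussian (EuclideanSpace ℝ (Fin T)))) ∧
      Var[fun x => ((colMatrix x)ᵀ * colMatrix x)⁻¹ 0 0;
        Measure.pi (fun _ : Fin (k + 1) => stdGaussian (EuclideanSpace ℝ (Fin T)))] =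
        1 / (((T : ℝ) - k - 2) * (T - k - 4)) - (1 / ((T : ℝ) - k - 2)) ^ 2 := by
  have hk' : (k : ℝ) + 4 < T := by exact_mod_cast hk
  have h4 : 0 < (T : ℝ) - k - 4 := by linarith
  have h2 : 0 < (T : ℝ) - k - 2 := by linarith
  refine memLp_two_and_variance_of_lintegral (measurable_inv_gram 0 0) ?_ (by positivity)
    (by positivity) ?_ ?_
  · filter_upwards [ae_linearIndependent_stdGaussian (E := EuclideanSpace ℝ (Fin T)) (k + 1)
      (by simp; omega)] with x hx
    exact (gram_posDef hx).inv.posSemidef.diag_nonneg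
  · have := lintegral_inv_gram_pow (T := T) (k := k) (by omega) 0
    rw [← lintegral_one_add_two_mul_rpow (m := (T : ℝ) - k) (by linarith)]
    simpa using this
  · have := lintegral_inv_gram_pow (T := T) (k := k) (by omega) 1
    rw [← lintegral_mul_one_add_two_mul_rpow (m := (T : ℝ) - k) (by linarith)]
    simpa using this

end Portfolio

/-! ### Transfer to the given observations. -/

theorem corollary3p4 {Ω : Type*} [MeasurableSpace Ω] (P : Measure Ω) [IsProbabilityMeasure P]
    (T n : ℕ) (hn : 1 ≤ n) (q : ℤ) (hq_def : q = (T : ℤ) - n - 1) (hq : 2 < q)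
    (S : Matrix (Fin n) (Fin n) ℝ) (hS : S.PosDef)
    (Y : Fin T → Ω → EuclideanSpace ℝ (Fin n))
    (hY_law : ∀ t, HasLaw (Y t) (multivariateGaussian 0 S) P)
    (hY_indep : iIndepFun Y P) :
    (∀ᵐ ω ∂P, (Portfolio.estimator (1 : Matrix (Fin T) (Fin T) ℝ) (fun t => Y t ω)).PosDef) ∧
    MemLp (fun ω => Portfolio.riskRatio S (1 : Matrix (Fin T) (Fin T) ℝ) (fun t => Y t ω)) 2 P ∧
    Var[fun ω => Portfolio.riskRatio S (1 : Matrix (Fin T) (Fin T) ℝ) (fun t => Y t ω); P] =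
      2 * (T : ℝ) ^ 2 / ((q : ℝ) ^ 2 * ((q : ℝ) - 2)) := by
  obtain ⟨k, rfl⟩ : ∃ k, n = k + 1 := ⟨n - 1, by omega⟩
  -- With n = k + 1, q > 2 says that the T - k degrees of freedom exceed 4, as the second inverse
  -- moment needs.
  have hkT : k + 4 < T := by push_cast at hq_def; omega
  obtain ⟨C, hCS, c, hc, hC1⟩ := Portfolio.exists_factor hS
  have hC : IsUnit C.det := by
    have h1 : IsUnit S.det := (Matrix.isUnit_iff_isUnit_det _).1 hS.isUnit
    rw [← hCS, Matrix.det_mul] at h1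
    exact isUnit_of_mul_isUnit_right h1
  have hYm : AEMeasurable (fun ω t => Y t ω) P :=
    aemeasurable_pi_lambda _ fun t => (hY_law t).aemeasurable
  have hObs := Portfolio.measurable_observations (T := T) C
  set ν := Measure.pi fun _ : Fin (k + 1) => stdGaussian (EuclideanSpace ℝ (Fin T)) with hν
  have hlaw : P.map (fun ω t => Y t ω) = ν.map (Portfolio.observations C) := by
    rw [(iIndepFun_iff_map_fun_eq_pi_map fun t => (hY_law t).aemeasurable).1 hY_indep, hν,
      Portfolio.map_observations hCS]
    simp_rw [(hY_law _).map_eq]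
  have hLI : ∀ᵐ x ∂ν, LinearIndependent ℝ x :=
    Portfolio.ae_linearIndependent_stdGaussian (k + 1) (by simp; omega)
  have hR := Portfolio.measurable_riskRatio S (1 : Matrix (Fin T) (Fin T) ℝ)
  have hRR : Portfolio.riskRatio S 1 ∘ Portfolio.observations C =ᵐ[ν]
      fun x => T * ((Portfolio.colMatrix x)ᵀ * Portfolio.colMatrix x)⁻¹ 0 0 := by
    filter_upwards [hLI] with x hx
    exact Portfolio.riskRatio_observations (by omega) hS hCS hc hC1 hx
  obtain ⟨hmem, hvar⟩ := Portfolio.memLp_two_and_variance_inv_gram hkT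
  refine ⟨?_, ?_, ?_⟩
  · refine ae_of_ae_map (p := fun y => (Portfolio.estimator 1 y).PosDef) hYm ?_
    rw [hlaw, ae_map_iff hObs.aemeasurable (Portfolio.measurableSet_estimator_one_posDef T _)]
    filter_upwards [hLI] with x hx
    exact Portfolio.estimator_observations_posDef (by omega) hC hx
  · refine MemLp.comp_of_map (f := fun ω t => Y t ω) (g := Portfolio.riskRatio S 1) ?_ hYm
    rw [hlaw, memLp_map_measure_iff hR.aestronglyMeasurable hObs.aemeasurable, memLp_congr_ae hRR]
    exact hmem.const_mul _
  · have h1 := variance_map (X := Portfolio.riskRatio S 1) hR.aemeasurable hYm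
    rw [hlaw, variance_map hR.aemeasurable hObs.aemeasurable, variance_congr hRR,
      variance_const_mul, hvar] at h1
    have hq' : (q : ℝ) = T - k - 2 := by rw [hq_def]; push_cast; ring
    have h2 : (T : ℝ) - k - 4 = q - 2 := by rw [hq']; ring
    have hq0 : (2 : ℝ) < q := by exact_mod_cast hq
    have hq1 : (q : ℝ) - 2 ≠ 0 := by linarith
    have hq2 : (q : ℝ) ≠ 0 := by linarith
    rw [h2, ← hq'] at h1
    refine h1.symm.trans ?_
    field_simp
    ring
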